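/- Let $k$ be a field, let $H$ be a commutative Hopf algebra over $k$ with antipode $S$ (bijective, since $H$ is commutative), and let $A$ be a commutative right $H$-comodule algebra, i.e. a commutative $k$-algebra with a right $H$-coaction $a\mapsto a_0\otimes a_1$ that is a homomorphism of $k$-algebras $A\to A\otimes_k H$. Let ${}_A\mathcal M^H$ be the abelian category of relative $(A,H)$-Hopf modules: its objects are the $A$-modules $M$ with a right $H$-coaction $\rho(m)=m_0\otimes m_1$ on the underlying $k$-vector space such that $\rho(am)=a_0m_0\otimes a_1m_1$ for $a\in A$, $m\in M$, and its morphisms are the $A$-linear, $H$-colinear maps. Let $M,N,P\in{}_A\mathcal M^H$, with $N$ finitely generated projective as an $A$-module. Regard $M\otimes_A N$ as an object of ${}_A\mathcal M^H$ with the coaction $\rho(m\otimes n)=m_0\otimes n_0\otimes m_1n_1$, and regard ${}_A\mathrm{Hom}(N,P)$, the $A$-module of $A$-linear maps $N\to P$, as an object of ${}_A\mathcal M^H$ with the coaction $f\mapsto f_0\otimes f_1$ determined by $$f_0(n)\otimes f_1=f(n_0)_0\otimes S^{-1}(n_1)f(n_0)_1\qquad(n\in N).$$ Let $\mathrm{pdim}$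 and $\mathrm{injdim}$ denote the projective and the injective dimension, with values in $\{-\infty,0,1,2,\dots,\infty\}$, of an object of ${}_A\mathcal M^H$, defined by the vanishing of the $\mathrm{Ext}$ groups of the category ${}_A\mathcal M^H$ (the zero object having dimension $-\infty$). Then $$\mathrm{pdim}(M\otimes_A N)\le \mathrm{pdim}(M)\qquad\text{and}\qquad \mathrm{injdim}({}_A\mathrm{Hom}(N,P))\le \mathrm{injdim}(P).$$ -/

import Mathlib

open CategoryTheory CategoryTheory.Limits
open scoped TensorProduct

universe u

noncomputable section

namespace RelHopf

/-! ### Comodules -/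

section Comodule

variable {k : Type*} {H : Type*} {M : Type*} {N : Type*} [CommRing k] [CommRing H]
  [AddCommGroup M] [Module k M] [AddCommGroup N] [Module k N]

/-- `ρ` makes the `k`-module `M` a right comodule over the coalgebra `H`:
`(ρ ⊗ id) ∘ ρ = (id ⊗ Δ) ∘ ρ` and `(id ⊗ ε) ∘ ρ = id`. -/
structure IsCoaction [Bialgebra k H] (ρ : M →ₗ[k] M ⊗[k] H) : Prop where
  coassoc : ∀ m, TensorProduct.assoc k M H H (ρ.rTensor H (ρ m)) =
    (Coalgebra.comul (R := k) (A := H)).lTensor M (ρ m)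
  counit : ∀ m, TensorProduct.rid k M ((Coalgebra.counit (R := k) (A := H)).lTensor M (ρ m)) = m

lemma assoc_rTensor_rTensor [Module k H] (f : M →ₗ[k] N) (x : (M ⊗[k] H) ⊗[k] H) :
    TensorProduct.assoc k N H H ((f.rTensor H).rTensor H x) =
      f.rTensor (H ⊗[k] H) (TensorProduct.assoc k M H H x) := by
  have : (TensorProduct.assoc k N H H).toLinearMap ∘ₗ (f.rTensor H).rTensor H =
      f.rTensor (H ⊗[k] H) ∘ₗ (TensorProduct.assoc k M H H).toLinearMap := by
    ext; simp
  exact LinearMap.congr_fun this x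

variable [Bialgebra k H]

/-- Naturality of the two sides of coassociativity. -/
lemma coassoc_left_natural {ρ : M →ₗ[k] M ⊗[k] H} {σ : N →ₗ[k] N ⊗[k] H} (f : M →ₗ[k] N)
    (hf : ∀ m, f.rTensor H (ρ m) = σ (f m)) (m : M) :
    f.rTensor (H ⊗[k] H) (TensorProduct.assoc k M H H (ρ.rTensor H (ρ m))) =
      TensorProduct.assoc k N H H (σ.rTensor H (σ (f m))) := by
  have h : f.rTensor H ∘ₗ ρ = σ ∘ₗ f := LinearMap.ext hf
  rw [← assoc_rTensor_rTensor, ← hf m, ← LinearMap.rTensor_comp_apply,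
    ← LinearMap.rTensor_comp_apply, h]

lemma coassoc_right_natural {ρ : M →ₗ[k] M ⊗[k] H} {σ : N →ₗ[k] N ⊗[k] H} (f : M →ₗ[k] N)
    (hf : ∀ m, f.rTensor H (ρ m) = σ (f m)) (m : M) :
    f.rTensor (H ⊗[k] H) ((Coalgebra.comul (R := k) (A := H)).lTensor M (ρ m)) =
      (Coalgebra.comul (R := k) (A := H)).lTensor N (σ (f m)) := by
  rw [← hf m, ← LinearMap.comp_apply (f.rTensor (H ⊗[k] H)),
    ← LinearMap.comp_apply (LinearMap.lTensor N _), LinearMap.rTensor_comp_lTensor,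
    LinearMap.lTensor_comp_rTensor]

lemma counit_natural {ρ : M →ₗ[k] M ⊗[k] H} {σ : N →ₗ[k] N ⊗[k] H} (f : M →ₗ[k] N)
    (hf : ∀ m, f.rTensor H (ρ m) = σ (f m)) (m : M) :
    f (TensorProduct.rid k M ((Coalgebra.counit (R := k) (A := H)).lTensor M (ρ m))) =
      TensorProduct.rid k N ((Coalgebra.counit (R := k) (A := H)).lTensor N (σ (f m))) := by
  rw [← hf m]
  generalize ρ m = x
  induction x with
  | zero => simp
  | tmul a b => simp
  | add a b ha hb => simp only [map_add, ha, hb]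

lemma IsCoaction.of_injective {ρ : M →ₗ[k] M ⊗[k] H} {σ : N →ₗ[k] N ⊗[k] H}
    (hσ : IsCoaction σ) (f : M →ₗ[k] N) (hf : ∀ m, f.rTensor H (ρ m) = σ (f m))
    (hi : Function.Injective f) (hi' : Function.Injective (f.rTensor (H ⊗[k] H))) :
    IsCoaction ρ where
  coassoc m := hi' (by
    rw [coassoc_left_natural f hf, coassoc_right_natural f hf, hσ.coassoc])
  counit m := hi (by rw [counit_natural f hf, hσ.counit])

lemma IsCoaction.of_surjective {ρ : M →ₗ[k] M ⊗[k] H} {σ : N →ₗ[k] N ⊗[k] H}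
    (hρ : IsCoaction ρ) (f : M →ₗ[k] N) (hf : ∀ m, f.rTensor H (ρ m) = σ (f m))
    (hs : Function.Surjective f) : IsCoaction σ where
  coassoc n := by
    obtain ⟨m, rfl⟩ := hs n
    rw [← coassoc_left_natural f hf, ← coassoc_right_natural f hf, hρ.coassoc]
  counit n := by
    obtain ⟨m, rfl⟩ := hs n
    rw [← counit_natural f hf, hρ.counit]

end Comodule

end RelHopf

/-- A right `H`-comodule algebra: a `k`-algebra `A` with a right `H`-coaction
that is a homomorphism of `k`-algebras `A → A ⊗ H`. -/
class ComoduleAlgebra (k H A : Type*) [CommRing k] [CommRing H] [Bialgebra k H]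
    [CommRing A] [Algebra k A] where
  coact : A →ₐ[k] A ⊗[k] H
  isCoaction : RelHopf.IsCoaction coact.toLinearMap

namespace RelHopf

section Action

variable {k H A : Type*} [CommRing k] [CommRing H] [Algebra k H]
  [CommRing A] [Algebra k A] {M N : Type*} [AddCommGroup M] [Module k M] [Module A M]
  [IsScalarTower k A M] [AddCommGroup N] [Module k N] [Module A N] [IsScalarTower k A N]

variable (k H A M) in
/-- The action of `A ⊗ H` on `M ⊗ H`: `(a ⊗ h) (m ⊗ g) = a m ⊗ h g`. -/
def tensorSMul : A ⊗[k] H →ₗ[k] M ⊗[k] H →ₗ[k] M ⊗[k] H :=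
  TensorProduct.map₂ (Algebra.lsmul k k M).toLinearMap (LinearMap.mul k H)

@[simp] lemma tensorSMul_tmul (a : A) (h g : H) (m : M) :
    tensorSMul k H A M (a ⊗ₜ h) (m ⊗ₜ g) = (a • m) ⊗ₜ (h * g) := by
  simp [tensorSMul]

lemma tensorSMul_natural (f : M →ₗ[A] N) (t : A ⊗[k] H) (x : M ⊗[k] H) :
    (f.restrictScalars k).rTensor H (tensorSMul k H A M t x) =
      tensorSMul k H A N t ((f.restrictScalars k).rTensor H x) := by
  induction t with
  | zero => simp
  | add s t hs ht => simp only [map_add, LinearMap.add_apply, hs, ht]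
  | tmul a h =>
    induction x with
    | zero => simp
    | add x y hx hy => simp only [map_add, hx, hy]
    | tmul m g => simp

end Action

end RelHopf

/-- A relative `(A, H)`-Hopf module: an `A`-module and right `H`-comodule such that
`ρ(a m) = a₀ m₀ ⊗ a₁ m₁`. -/
structure RelHopfModule (k H A : Type u) [CommRing k] [CommRing H] [Bialgebra k H]
    [CommRing A] [Algebra k A] [ComoduleAlgebra k H A] where
  carrier : Type u
  [addCommGroup : AddCommGroup carrier]
  [baseModule : Module k carrier]
  [module : Module A carrier]
  [isScalarTower : IsScalarTower k A carrier]
  coact : carrier →ₗ[k] carrier ⊗[k] H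
  isCoaction : RelHopf.IsCoaction coact
  coact_smul : ∀ (a : A) (m : carrier), coact (a • m) =
    RelHopf.tensorSMul k H A carrier (ComoduleAlgebra.coact a) (coact m)

namespace RelHopfModule

attribute [instance] addCommGroup baseModule module isScalarTower

variable {k H A : Type u} [CommRing k] [CommRing H] [Bialgebra k H]
    [CommRing A] [Algebra k A] [ComoduleAlgebra k H A]

instance : CoeSort (RelHopfModule k H A) (Type u) := ⟨carrier⟩

/-- Morphisms of relative Hopf modules: `A`-linear and `H`-colinear maps. -/
@[ext]
structure Hom (M N : RelHopfModule k H A) where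
  toLin : M →ₗ[A] N
  colinear : ∀ m, (toLin.restrictScalars k).rTensor H (M.coact m) = N.coact (toLin m)

instance : Category (RelHopfModule k H A) where
  Hom := Hom
  id M := ⟨LinearMap.id, fun m => by
    have : (LinearMap.id : M →ₗ[A] M).restrictScalars k = LinearMap.id := rfl
    simp [this]⟩
  comp f g := ⟨g.toLin ∘ₗ f.toLin, fun m => by
    rw [LinearMap.restrictScalars_comp, LinearMap.rTensor_comp, LinearMap.comp_apply, f.colinear,
      g.colinear, LinearMap.comp_apply]⟩

variable {M N P : RelHopfModule k H A}

@[ext] lemma hom_ext {f g : M ⟶ N} (h : ∀ m, f.toLin m = g.toLin m) : f = g :=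
  Hom.ext (LinearMap.ext h)

@[simp] lemma id_toLin : Hom.toLin (𝟙 M) = LinearMap.id := rfl
@[simp] lemma comp_toLin (f : M ⟶ N) (g : N ⟶ P) : (f ≫ g).toLin = g.toLin ∘ₗ f.toLin := rfl

instance : Zero (M ⟶ N) := ⟨⟨0, fun m => by simp⟩⟩
instance : Add (M ⟶ N) := ⟨fun f g => ⟨f.toLin + g.toLin, fun m => by
  rw [LinearMap.restrictScalars_add, LinearMap.rTensor_add, LinearMap.add_apply, f.colinear,
    g.colinear, LinearMap.add_apply, map_add]⟩⟩
instance : Neg (M ⟶ N) := ⟨fun f => ⟨-f.toLin, fun m => by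
  rw [LinearMap.restrictScalars_neg, LinearMap.rTensor_neg, LinearMap.neg_apply, f.colinear,
    LinearMap.neg_apply, map_neg]⟩⟩

@[simp] lemma zero_toLin : Hom.toLin (0 : M ⟶ N) = 0 := rfl
@[simp] lemma add_toLin (f g : M ⟶ N) : (f + g).toLin = f.toLin + g.toLin := rfl
@[simp] lemma neg_toLin (f : M ⟶ N) : (-f).toLin = -f.toLin := rfl

instance : AddCommGroup (M ⟶ N) where
  add_assoc f g h := by ext; simp [add_assoc]
  zero_add f := by ext; simp
  add_zero f := by ext; simp
  add_comm f g := by ext; simp [add_comm]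
  neg_add_cancel f := by ext; simp
  nsmul := nsmulRec
  zsmul := zsmulRec

instance : Preadditive (RelHopfModule k H A) where
  add_comp _ _ _ f f' g := by ext; simp
  comp_add _ _ _ f g g' := by ext; simp

/-! ### Zero object and binary products -/

variable (k H A) in
/-- The zero relative Hopf module. -/
def zeroObj : RelHopfModule k H A where
  carrier := PUnit
  coact := 0
  isCoaction := ⟨fun _ => by simp, fun _ => rfl⟩
  coact_smul _ _ := by simp

lemma zeroObj_isZero : IsZero (zeroObj k H A) := by
  rw [IsZero.iff_id_eq_zero]
  ext m
  rfl

instance : HasZeroObject (RelHopfModule k H A) := ⟨⟨_, zeroObj_isZero⟩⟩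

section Prod

variable (M N)

/-- The coaction on a direct sum. -/
def prodCoact : M × N →ₗ[k] (M × N) ⊗[k] H :=
  ((LinearMap.inl k M N).rTensor H ∘ₗ M.coact).coprod
    ((LinearMap.inr k M N).rTensor H ∘ₗ N.coact)

lemma prodCoact_inl (m : M) :
    (LinearMap.inl k M N).rTensor H (M.coact m) = prodCoact M N (LinearMap.inl k M N m) := by
  simp [prodCoact]

lemma prodCoact_inr (n : N) :
    (LinearMap.inr k M N).rTensor H (N.coact n) = prodCoact M N (LinearMap.inr k M N n) := by
  simp [prodCoact]

/-- The direct sum of two relative Hopf modules. -/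
def prod : RelHopfModule k H A where
  carrier := M × N
  coact := prodCoact M N
  isCoaction := by
    constructor
    · rintro ⟨m, n⟩
      have : (m, n) = LinearMap.inl k M N m + LinearMap.inr k M N n := by simp
      rw [this]
      simp only [map_add]
      rw [← RelHopf.coassoc_left_natural _ (prodCoact_inl M N), ← RelHopf.coassoc_right_natural _ (prodCoact_inl M N),
        ← RelHopf.coassoc_left_natural _ (prodCoact_inr M N), ← RelHopf.coassoc_right_natural _ (prodCoact_inr M N),
        M.isCoaction.coassoc, N.isCoaction.coassoc]
    · rintro ⟨m, n⟩
      have : (m, n) = LinearMap.inl k M N m + LinearMap.inr k M N n := by simp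
      rw [this]
      simp only [map_add]
      rw [← RelHopf.counit_natural _ (prodCoact_inl M N), ← RelHopf.counit_natural _ (prodCoact_inr M N),
        M.isCoaction.counit, N.isCoaction.counit]
  coact_smul := by
    rintro a ⟨m, n⟩
    have h1 := RelHopf.tensorSMul_natural (k := k) (H := H) (LinearMap.inl A M N)
      (ComoduleAlgebra.coact a) (M.coact m)
    have h2 := RelHopf.tensorSMul_natural (k := k) (H := H) (LinearMap.inr A M N)
      (ComoduleAlgebra.coact a) (N.coact n)
    have e1 : (LinearMap.inl A M N).restrictScalars k = LinearMap.inl k M N := rfl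
    have e2 : (LinearMap.inr A M N).restrictScalars k = LinearMap.inr k M N := rfl
    rw [e1] at h1
    rw [e2] at h2
    simp only [prodCoact, Prod.smul_mk, LinearMap.coprod_apply, LinearMap.comp_apply,
      M.coact_smul, N.coact_smul, map_add, h1, h2]

/-- The first projection. -/
def fst : prod M N ⟶ M := ⟨LinearMap.fst A M N, fun x => by
  have e : (LinearMap.fst A M N).restrictScalars k = LinearMap.fst k M N := rfl
  erw [e]
  obtain ⟨m, n⟩ := x
  change (LinearMap.fst k M N).rTensor H (prodCoact M N (m, n)) = M.coact m
  simp only [prodCoact, LinearMap.coprod_apply, LinearMap.comp_apply, map_add]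
  rw [← LinearMap.comp_apply, ← LinearMap.comp_apply (LinearMap.rTensor H _), ← LinearMap.rTensor_comp,
    ← LinearMap.rTensor_comp]
  simp⟩

/-- The second projection. -/
def snd : prod M N ⟶ N := ⟨LinearMap.snd A M N, fun x => by
  have e : (LinearMap.snd A M N).restrictScalars k = LinearMap.snd k M N := rfl
  erw [e]
  obtain ⟨m, n⟩ := x
  change (LinearMap.snd k M N).rTensor H (prodCoact M N (m, n)) = N.coact n
  simp only [prodCoact, LinearMap.coprod_apply, LinearMap.comp_apply, map_add]
  rw [← LinearMap.comp_apply, ← LinearMap.comp_apply (LinearMap.rTensor H _), ← LinearMap.rTensor_comp,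
    ← LinearMap.rTensor_comp]
  simp⟩

/-- The map into a product given by its components. -/
def prodLift {Z : RelHopfModule k H A} (f : Z ⟶ M) (g : Z ⟶ N) : Z ⟶ prod M N :=
  ⟨f.toLin.prod g.toLin, fun z => by
    have e : ((f.toLin.prod g.toLin).restrictScalars k : Z →ₗ[k] M × N) =
      LinearMap.inl k M N ∘ₗ f.toLin.restrictScalars k +
      LinearMap.inr k M N ∘ₗ g.toLin.restrictScalars k := by ext <;> simp
    change ((f.toLin.prod g.toLin).restrictScalars k : Z →ₗ[k] M × N).rTensor H (Z.coact z) =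
      prodCoact M N (f.toLin z, g.toLin z)
    rw [e, LinearMap.rTensor_add, LinearMap.rTensor_comp, LinearMap.rTensor_comp,
      LinearMap.add_apply, LinearMap.comp_apply, LinearMap.comp_apply, f.colinear, g.colinear]
    simp [prodCoact]⟩

/-- The direct sum is a categorical product. -/
def prodIsLimit : IsLimit (BinaryFan.mk (fst M N) (snd M N)) :=
  BinaryFan.IsLimit.mk _ (fun f g => prodLift M N f g) (fun _ _ => rfl) (fun _ _ => rfl)
    (fun f g m h1 h2 => by
      subst h1 h2
      rfl)

end Prod

instance : HasBinaryProducts (RelHopfModule k H A) :=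
  have : ∀ {X Y : RelHopfModule k H A}, HasLimit (pair X Y) :=
    fun {X Y} => ⟨⟨⟨_, prodIsLimit X Y⟩⟩⟩
  hasBinaryProducts_of_hasLimit_pair _

instance : HasFiniteProducts (RelHopfModule k H A) :=
  hasFiniteProducts_of_has_binary_and_terminal

/-! ### Cokernels -/

section Coker

variable (f : M ⟶ N)

lemma cokerCoact_aux : (LinearMap.range f.toLin).restrictScalars k ≤
    LinearMap.ker (((LinearMap.range f.toLin).mkQ.restrictScalars k).rTensor H ∘ₗ N.coact) := by
  rintro _ ⟨m, rfl⟩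
  rw [LinearMap.mem_ker, LinearMap.comp_apply, ← f.colinear,
    ← LinearMap.comp_apply, ← LinearMap.rTensor_comp]
  have : (LinearMap.range f.toLin).mkQ.restrictScalars k ∘ₗ f.toLin.restrictScalars k = 0 := by
    ext x; simp
  rw [this]; simp

/-- The coaction on the cokernel of a morphism. -/
def cokerCoact : (N ⧸ LinearMap.range f.toLin) →ₗ[k] (N ⧸ LinearMap.range f.toLin) ⊗[k] H :=
  ((LinearMap.range f.toLin).restrictScalars k).liftQ
    (((LinearMap.range f.toLin).mkQ.restrictScalars k).rTensor H ∘ₗ N.coact) (cokerCoact_aux f) ∘ₗ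
  (Submodule.Quotient.restrictScalarsEquiv k (LinearMap.range f.toLin)).symm.toLinearMap

lemma cokerCoact_mkQ (n : N) :
    ((LinearMap.range f.toLin).mkQ.restrictScalars k).rTensor H (N.coact n) =
      cokerCoact f ((LinearMap.range f.toLin).mkQ n) := rfl

lemma cokerCoact_smul (a : A) (x : N ⧸ LinearMap.range f.toLin) :
    cokerCoact f (a • x) =
      RelHopf.tensorSMul k H A (N ⧸ LinearMap.range f.toLin) (ComoduleAlgebra.coact a)
        (cokerCoact f x) := by
  obtain ⟨n, rfl⟩ := Submodule.mkQ_surjective _ x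
  have h := RelHopf.tensorSMul_natural (k := k) (H := H) (LinearMap.range f.toLin).mkQ
    (ComoduleAlgebra.coact a) (N.coact n)
  rw [← N.coact_smul] at h
  exact h

/-- The cokernel of a morphism of relative Hopf modules. -/
def coker : RelHopfModule k H A where
  carrier := N ⧸ LinearMap.range f.toLin
  coact := cokerCoact f
  isCoaction := N.isCoaction.of_surjective
    ((LinearMap.range f.toLin).mkQ.restrictScalars k) (cokerCoact_mkQ f)
    (LinearMap.range f.toLin).mkQ_surjective
  coact_smul := cokerCoact_smul f

/-- The projection to the cokernel. -/
def cokerπ : N ⟶ coker f := ⟨(LinearMap.range f.toLin).mkQ, cokerCoact_mkQ f⟩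

lemma comp_cokerπ : f ≫ cokerπ f = 0 := by
  ext m
  exact (Submodule.Quotient.mk_eq_zero _).2 ⟨m, rfl⟩

/-- A surjective morphism descends colinear maps that vanish on its kernel. -/
def descOfSurjective {Q Z : RelHopfModule k H A} (p : N ⟶ Q) (hp : Function.Surjective p.toLin)
    (g : N ⟶ Z) (hg : LinearMap.ker p.toLin ≤ LinearMap.ker g.toLin) : Q ⟶ Z :=
  ⟨(LinearMap.ker p.toLin).liftQ g.toLin hg ∘ₗ
      (p.toLin.quotKerEquivOfSurjective hp).symm.toLinearMap, by
    set d := (LinearMap.ker p.toLin).liftQ g.toLin hg ∘ₗ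
      (p.toLin.quotKerEquivOfSurjective hp).symm.toLinearMap with hd
    have key : ∀ n, d (p.toLin n) = g.toLin n := fun n => by
      have : (p.toLin.quotKerEquivOfSurjective hp).symm (p.toLin n) =
          (LinearMap.ker p.toLin).mkQ n := by
        rw [LinearEquiv.symm_apply_eq]; rfl
      simp [hd, this]
    have key' : d.restrictScalars k ∘ₗ p.toLin.restrictScalars k = g.toLin.restrictScalars k :=
      LinearMap.ext key
    intro q
    obtain ⟨n, rfl⟩ := hp q
    rw [← p.colinear, ← LinearMap.comp_apply, ← LinearMap.rTensor_comp, key', g.colinear, key]⟩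

lemma comp_descOfSurjective {Q Z : RelHopfModule k H A} (p : N ⟶ Q)
    (hp : Function.Surjective p.toLin)
    (g : N ⟶ Z) (hg : LinearMap.ker p.toLin ≤ LinearMap.ker g.toLin) :
    p ≫ descOfSurjective p hp g hg = g := by
  ext n
  have : (p.toLin.quotKerEquivOfSurjective hp).symm (p.toLin n) =
      (LinearMap.ker p.toLin).mkQ n := by
    rw [LinearEquiv.symm_apply_eq]; rfl
  simp [descOfSurjective, this]

lemma epi_of_surjective {Q : RelHopfModule k H A} (p : N ⟶ Q)
    (hp : Function.Surjective p.toLin) : Epi p := ⟨fun g h e => by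
  ext q
  obtain ⟨n, rfl⟩ := hp q
  exact LinearMap.congr_fun (congrArg Hom.toLin e) n⟩

/-- A surjective morphism whose kernel is the range of `f` is a cokernel of `f`. -/
def isColimitOfSurjective {Q : RelHopfModule k H A} (p : N ⟶ Q)
    (hp : Function.Surjective p.toLin) (w : f ≫ p = 0)
    (hker : LinearMap.ker p.toLin ≤ LinearMap.range f.toLin) :
    IsColimit (CokernelCofork.ofπ p w) :=
  have := epi_of_surjective p hp
  CokernelCofork.IsColimit.ofπ' p w fun {Z} g hg =>
    ⟨descOfSurjective p hp g (hker.trans (by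
      rintro _ ⟨m, rfl⟩
      exact LinearMap.congr_fun (congrArg Hom.toLin hg) m)), comp_descOfSurjective _ _ _ _⟩

instance : HasCokernels (RelHopfModule k H A) := ⟨fun f => ⟨⟨⟨_,
  isColimitOfSurjective f (cokerπ f) (Submodule.mkQ_surjective _) (comp_cokerπ f)
    (Submodule.ker_mkQ _).le⟩⟩⟩⟩

lemma surjective_of_epi (f : M ⟶ N) [Epi f] : Function.Surjective f.toLin := by
  have h : cokerπ f = 0 := by
    rw [← cancel_epi f, comp_cokerπ, comp_zero]
  rw [← LinearMap.range_eq_top, ← Submodule.ker_mkQ (LinearMap.range f.toLin)]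
  have : (LinearMap.range f.toLin).mkQ = 0 := congrArg Hom.toLin h
  rw [this, LinearMap.ker_zero]

end Coker

lemma mono_of_injective {K : RelHopfModule k H A} (i : K ⟶ M)
    (hi : Function.Injective i.toLin) : Mono i := ⟨fun g h e => by
  ext z
  exact hi (LinearMap.congr_fun (congrArg Hom.toLin e) z)⟩

/-! ### Kernels (for `H` flat over `k`) -/

section Ker

variable [Module.Flat k H]

lemma rTensor_injective {X Y : Type*} [AddCommGroup X] [Module k X] [AddCommGroup Y] [Module k Y]
    (i : X →ₗ[k] Y) (hi : Function.Injective i) : Function.Injective (i.rTensor H) :=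
  Module.Flat.rTensor_preserves_injective_linearMap i hi

variable (f : M ⟶ N)

lemma kerCoact_mem (x : LinearMap.ker f.toLin) :
    M.coact ((LinearMap.ker f.toLin).subtype x) ∈
      LinearMap.range (((LinearMap.ker f.toLin).subtype.restrictScalars k).rTensor H) := by
  have ex : Function.Exact ((LinearMap.ker f.toLin).subtype.restrictScalars k)
      (f.toLin.restrictScalars k) := by
    intro m
    simp
  have := Module.Flat.rTensor_exact H ex
  refine (this _).1 ?_
  rw [f.colinear]
  simp

/-- The coaction on the kernel of a morphism. -/
def kerCoact : LinearMap.ker f.toLin →ₗ[k] LinearMap.ker f.toLin ⊗[k] H :=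
  (LinearEquiv.ofInjective (((LinearMap.ker f.toLin).subtype.restrictScalars k).rTensor H)
    (rTensor_injective _ (Submodule.subtype_injective _))).symm.toLinearMap ∘ₗ
  (M.coact ∘ₗ (LinearMap.ker f.toLin).subtype.restrictScalars k).codRestrict _ (kerCoact_mem f)

lemma kerCoact_subtype (x : LinearMap.ker f.toLin) :
    ((LinearMap.ker f.toLin).subtype.restrictScalars k).rTensor H (kerCoact f x) =
      M.coact ((LinearMap.ker f.toLin).subtype x) := by
  have := LinearEquiv.apply_symm_apply
    (LinearEquiv.ofInjective (((LinearMap.ker f.toLin).subtype.restrictScalars k).rTensor H)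
    (rTensor_injective _ (Submodule.subtype_injective _)))
    ((M.coact ∘ₗ (LinearMap.ker f.toLin).subtype.restrictScalars k).codRestrict _
      (kerCoact_mem f) x)
  exact congrArg Subtype.val this

/-- The kernel of a morphism of relative Hopf modules. -/
def ker : RelHopfModule k H A where
  carrier := LinearMap.ker f.toLin
  coact := kerCoact f
  isCoaction := M.isCoaction.of_injective
    ((LinearMap.ker f.toLin).subtype.restrictScalars k) (kerCoact_subtype f)
    (Submodule.subtype_injective _)
    (Module.Flat.rTensor_preserves_injective_linearMap _ (Submodule.subtype_injective _))
  coact_smul a x := by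
    apply rTensor_injective ((LinearMap.ker f.toLin).subtype.restrictScalars k)
      (Submodule.subtype_injective _)
    rw [RelHopf.tensorSMul_natural, kerCoact_subtype, kerCoact_subtype, map_smul, M.coact_smul]

/-- The inclusion of the kernel. -/
def kerι : ker f ⟶ M := ⟨(LinearMap.ker f.toLin).subtype, kerCoact_subtype f⟩

lemma kerι_comp : kerι f ≫ f = 0 := by
  ext m
  exact m.2

/-- Lifting a morphism through an injective one. -/
def liftOfInjective {K Z : RelHopfModule k H A} (i : K ⟶ M) (hi : Function.Injective i.toLin)
    (g : Z ⟶ M) (hg : LinearMap.range g.toLin ≤ LinearMap.range i.toLin) : Z ⟶ K :=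
  ⟨(LinearEquiv.ofInjective i.toLin hi).symm.toLinearMap ∘ₗ
      g.toLin.codRestrict _ (fun z => hg ⟨z, rfl⟩), by
    set l := (LinearEquiv.ofInjective i.toLin hi).symm.toLinearMap ∘ₗ
      g.toLin.codRestrict _ (fun z => hg ⟨z, rfl⟩) with hl
    have key : ∀ z, i.toLin (l z) = g.toLin z := fun z =>
      congrArg Subtype.val (LinearEquiv.apply_symm_apply (LinearEquiv.ofInjective i.toLin hi)
        (g.toLin.codRestrict _ (fun z => hg ⟨z, rfl⟩) z))
    have key' : i.toLin.restrictScalars k ∘ₗ l.restrictScalars k = g.toLin.restrictScalars k :=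
      LinearMap.ext key
    intro z
    apply rTensor_injective (i.toLin.restrictScalars k) hi
    rw [← LinearMap.comp_apply, ← LinearMap.rTensor_comp, key', g.colinear, i.colinear, key]⟩

lemma liftOfInjective_comp {K Z : RelHopfModule k H A} (i : K ⟶ M)
    (hi : Function.Injective i.toLin)
    (g : Z ⟶ M) (hg : LinearMap.range g.toLin ≤ LinearMap.range i.toLin) :
    liftOfInjective i hi g hg ≫ i = g := by
  ext z
  exact congrArg Subtype.val (LinearEquiv.apply_symm_apply (LinearEquiv.ofInjective i.toLin hi)
        (g.toLin.codRestrict _ (fun z => hg ⟨z, rfl⟩) z))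

/-- An injective morphism whose range is the kernel of `f` is a kernel of `f`. -/
def isLimitOfInjective {K : RelHopfModule k H A} (i : K ⟶ M)
    (hi : Function.Injective i.toLin) (w : i ≫ f = 0)
    (hker : LinearMap.ker f.toLin ≤ LinearMap.range i.toLin) :
    IsLimit (KernelFork.ofι i w) :=
  have := mono_of_injective i hi
  KernelFork.IsLimit.ofι' i w fun {Z} g hg =>
    ⟨liftOfInjective i hi g (le_trans (by
      rintro _ ⟨m, rfl⟩
      exact LinearMap.congr_fun (congrArg Hom.toLin hg) m) hker), liftOfInjective_comp _ _ _ _⟩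

instance : HasKernels (RelHopfModule k H A) := ⟨fun f => ⟨⟨⟨_,
  isLimitOfInjective f (kerι f) (Submodule.subtype_injective _) (kerι_comp f)
    (Submodule.range_subtype _).ge⟩⟩⟩⟩

lemma injective_of_mono (f : M ⟶ N) [Mono f] : Function.Injective f.toLin := by
  have h : kerι f = 0 := by
    rw [← cancel_mono f, kerι_comp, zero_comp]
  rw [← LinearMap.ker_eq_bot, ← Submodule.range_subtype (LinearMap.ker f.toLin)]
  have : (LinearMap.ker f.toLin).subtype = 0 := congrArg Hom.toLin h
  rw [this, LinearMap.range_zero]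

/-- If `H` is flat over `k`, the category of relative Hopf modules is abelian. -/
instance : Abelian (RelHopfModule k H A) where
  normalMonoOfMono f _ := ⟨{
    Z := coker f
    g := cokerπ f
    w := comp_cokerπ f
    isLimit := isLimitOfInjective _ f (injective_of_mono f) (comp_cokerπ f)
      (Submodule.ker_mkQ _).le }⟩
  normalEpiOfEpi f _ := ⟨{
    W := ker f
    g := kerι f
    w := kerι_comp f
    isColimit := isColimitOfSurjective _ f (surjective_of_epi f) (kerι_comp f)
      (Submodule.range_subtype _).ge }⟩

end Ker

end RelHopfModule

namespace RelHopf

/-! ### The antipode of a commutative Hopf algebra -/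

section Antipode

variable {k H : Type*} [CommRing k] [CommRing H] [HopfAlgebra k H]

open Coalgebra HopfAlgebra WithConv in
/-- The antipode of a commutative Hopf algebra is an involution. -/
lemma antipode_antipode (h : H) : antipode k (antipode k h) = h := by
  have h1 : toConv (antipode k ∘ₗ antipode k (A := H)) * toConv (antipode k (A := H)) = 1 := by
    ext c
    rw [(ℛ k c).convMul_apply]
    simp only [LinearMap.comp_apply, ← antipode_mul_distrib, ← map_sum,
      sum_antipode_mul_eq_algebraMap_counit (ℛ k c)]
    simp [Algebra.algebraMap_eq_smul_one]
  have h2 : toConv (antipode k (A := H)) * toConv LinearMap.id = 1 := LinearMap.antipode_mul_id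
  have h3 : toConv (antipode k ∘ₗ antipode k (A := H)) = toConv LinearMap.id :=
    left_inv_eq_right_inv h1 h2
  exact LinearMap.congr_fun (toConv_injective h3) h

variable (k H) in
/-- The antipode of a commutative Hopf algebra, as a bijection. -/
def antipodeEquiv : H ≃ₗ[k] H :=
  LinearEquiv.ofInvolutive (HopfAlgebra.antipode k) antipode_antipode

variable (k H) in
/-- The inverse `S⁻¹` of the antipode. -/
def antipodeInv : H →ₗ[k] H := (antipodeEquiv k H).symm.toLinearMap

lemma antipodeInv_antipode (h : H) : antipodeInv k H (HopfAlgebra.antipode k h) = h :=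
  (antipodeEquiv k H).symm_apply_apply h

lemma antipodeInv_eq (h : H) : antipodeInv k H h = HopfAlgebra.antipode k h := by
  rw [← antipode_antipode (k := k) h, antipodeInv_antipode, antipode_antipode]

end Antipode

/-! ### Coefficients -/

section Coeff

variable {k A : Type*} [CommRing k] [CommRing A] [Algebra k A]
  {N P : Type*} [AddCommGroup N] [Module A N]
  [AddCommGroup P] [Module k P] [Module A P] [IsScalarTower k A P]
  (V : Type*) [AddCommGroup V] [Module k V]

variable (k A N P) in
/-- The canonical map `Hom_A(N, P) ⊗ V → Hom_A(N, P ⊗ V)`, `f ⊗ v ↦ (n ↦ f(n) ⊗ v)`. -/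
def homTensorMap : (N →ₗ[A] P) ⊗[k] V →ₗ[k] (N →ₗ[A] P ⊗[k] V) :=
  TensorProduct.lift (LinearMap.mk₂ k
    (fun f v => ((TensorProduct.AlgebraTensorModule.mk k A P V).flip v) ∘ₗ f)
    (fun f g v => by ext; simp [TensorProduct.add_tmul])
    (fun c f v => by ext; simp [TensorProduct.smul_tmul'])
    (fun f v w => by ext; simp)
    (fun c f v => by ext; simp))

@[simp] lemma homTensorMap_tmul (f : N →ₗ[A] P) (v : V) (n : N) :
    homTensorMap k A N P V (f ⊗ₜ v) n = f n ⊗ₜ v := rfl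

/-- For `N` finitely generated projective, the canonical map is bijective. -/
lemma homTensorMap_bijective [Module.Finite A N] [Module.Projective A N] :
    Function.Bijective (homTensorMap k A N P V) := by
  obtain ⟨n, p, s, -, -, hps⟩ := Module.Finite.exists_comp_eq_id_of_projective A N
  have hN : ∀ x : N, x = ∑ i, s x i • p (Pi.single i 1) := fun x => by
    have hs : s x = ∑ i, s x i • (Pi.single i 1 : Fin n → A) := by
      ext j
      simp [Finset.sum_apply, Pi.single_apply]
    have h := LinearMap.congr_fun hps x
    rw [LinearMap.comp_apply, hs] at h
    simpa using h.symm
  let c : Fin n → P →ₗ[k] (N →ₗ[A] P) := fun i =>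
    { toFun := fun y => (LinearMap.toSpanSingleton A P y) ∘ₗ (LinearMap.proj i ∘ₗ s)
      map_add' := fun y z => by ext x; exact smul_add (s x i) y z
      map_smul' := fun r y => by ext x; exact smul_comm (s x i) r y }
  have hc : ∀ i y x, c i y x = s x i • y := fun i y x => rfl
  let inv : (N →ₗ[A] P ⊗[k] V) → (N →ₗ[A] P) ⊗[k] V := fun φ =>
    ∑ i, (c i).rTensor V (φ (p (Pi.single i 1)))
  have key : ∀ i (y : P ⊗[k] V) x, homTensorMap k A N P V ((c i).rTensor V y) x = s x i • y := by
    intro i y x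
    induction y with
    | zero => simp
    | add y z hy hz => simp only [map_add, LinearMap.add_apply, hy, hz, smul_add]
    | tmul y v => simp [hc, TensorProduct.smul_tmul']
  refine Function.bijective_iff_has_inverse.2 ⟨inv, fun x => ?_, fun φ => ?_⟩
  · induction x with
    | zero => simp [inv]
    | add x y hx hy =>
      simp only [inv, map_add, LinearMap.add_apply, Finset.sum_add_distrib] at hx hy ⊢
      rw [hx, hy]
    | tmul f v =>
      simp only [inv, homTensorMap_tmul, LinearMap.rTensor_tmul, ← TensorProduct.sum_tmul]
      congr 1
      ext x
      conv_rhs => rw [hN x]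
      simp only [LinearMap.sum_apply, hc, map_sum, map_smul]
  · ext x
    simp only [inv, map_sum, LinearMap.sum_apply, key]
    conv_rhs => rw [hN x]
    simp only [map_sum, map_smul]

end Coeff

end RelHopf

namespace RelHopfModule

/-! ### The tensor product over `A` -/

section Tensor

variable {k H A : Type u} [CommRing k] [CommRing H] [Bialgebra k H]
    [CommRing A] [Algebra k A] [ComoduleAlgebra k H A] (M N : RelHopfModule k H A)
    (V : Type*) [CommRing V] [Algebra k V]

/-- The bilinear map `(m ⊗ v, n ⊗ w) ↦ (m ⊗_A n) ⊗ v w`. -/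
def tensorMulMap : M ⊗[k] V →ₗ[k] N ⊗[k] V →ₗ[k] (M ⊗[A] N) ⊗[k] V :=
  TensorProduct.map₂
    (LinearMap.mk₂ k (fun m n => m ⊗ₜ[A] n) (fun m m' n => TensorProduct.add_tmul m m' n)
      (fun _ _ _ => rfl) (fun m n n' => TensorProduct.tmul_add m n n')
      (fun c m n => by rw [TensorProduct.tmul_smul]))
    (LinearMap.mul k V)

@[simp] lemma tensorMulMap_tmul (m : M) (n : N) (v w : V) :
    tensorMulMap M N V (m ⊗ₜ v) (n ⊗ₜ w) = (m ⊗ₜ[A] n) ⊗ₜ[k] (v * w) := rfl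

lemma tensorMulMap_smul_left (t : A ⊗[k] V) (x : M ⊗[k] V) (y : N ⊗[k] V) :
    tensorMulMap M N V (RelHopf.tensorSMul k V A M t x) y =
      RelHopf.tensorSMul k V A (M ⊗[A] N) t (tensorMulMap M N V x y) := by
  induction t with
  | zero => simp
  | add s t hs ht => simp only [map_add, LinearMap.add_apply, hs, ht]
  | tmul a v =>
    induction x with
    | zero => simp
    | add x x' hx hx' => simp only [map_add, LinearMap.add_apply, hx, hx']
    | tmul m w =>
      induction y with
      | zero => simp
      | add y y' hy hy' => simp only [map_add, hy, hy']
      | tmul n z => simp [TensorProduct.smul_tmul', mul_assoc]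

lemma tensorMulMap_smul_right (t : A ⊗[k] V) (x : M ⊗[k] V) (y : N ⊗[k] V) :
    tensorMulMap M N V x (RelHopf.tensorSMul k V A N t y) =
      RelHopf.tensorSMul k V A (M ⊗[A] N) t (tensorMulMap M N V x y) := by
  induction t with
  | zero => simp
  | add s t hs ht => simp only [map_add, LinearMap.add_apply, hs, ht]
  | tmul a v =>
    induction x with
    | zero => simp
    | add x x' hx hx' => simp only [map_add, LinearMap.add_apply, hx, hx']
    | tmul m w =>
      induction y with
      | zero => simp
      | add y y' hy hy' => simp only [map_add, hy, hy']
      | tmul n z => simp [mul_left_comm]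

/-- The coaction `m ⊗ n ↦ m₀ ⊗ n₀ ⊗ m₁ n₁` on `M ⊗_A N`, as an additive map. -/
def tensorCoactAux : M ⊗[A] N →+ (M ⊗[A] N) ⊗[k] H :=
  TensorProduct.liftAddHom
    { toFun := fun m => (tensorMulMap M N H (M.coact m) ∘ₗ N.coact).toAddMonoidHom
      map_zero' := by ext; simp
      map_add' := fun m m' => by ext; simp }
    (fun a m n => by
      change tensorMulMap M N H (M.coact (a • m)) (N.coact n) =
        tensorMulMap M N H (M.coact m) (N.coact (a • n))
      rw [M.coact_smul, N.coact_smul, tensorMulMap_smul_left, tensorMulMap_smul_right])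

/-- The coaction `m ⊗ n ↦ m₀ ⊗ n₀ ⊗ m₁ n₁` on `M ⊗_A N`. -/
def tensorCoact : M ⊗[A] N →ₗ[k] (M ⊗[A] N) ⊗[k] H where
  toFun := tensorCoactAux M N
  map_add' := map_add _
  map_smul' c x := by
    induction x with
    | zero => simp
    | add x y hx hy => rw [smul_add, map_add, hx, hy, map_add, smul_add]
    | tmul m n =>
      change tensorMulMap M N H (M.coact (c • m)) (N.coact n) =
        c • tensorMulMap M N H (M.coact m) (N.coact n)
      simp

@[simp] lemma tensorCoact_tmul (m : M) (n : N) :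
    tensorCoact M N (m ⊗ₜ n) = tensorMulMap M N H (M.coact m) (N.coact n) := rfl

lemma assoc_tensorMulMap (x : M ⊗[k] H) (y : N ⊗[k] H) (h g : H) :
    TensorProduct.assoc k (M ⊗[A] N) H H (tensorMulMap M N H x y ⊗ₜ (h * g)) =
      tensorMulMap M N (H ⊗[k] H) (TensorProduct.assoc k M H H (x ⊗ₜ h))
        (TensorProduct.assoc k N H H (y ⊗ₜ g)) := by
  induction x with
  | zero => simp
  | add x x' hx hx' =>
    simp only [map_add, LinearMap.add_apply, TensorProduct.add_tmul, hx, hx']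
  | tmul m w =>
    induction y with
    | zero => simp
    | add y y' hy hy' => simp only [map_add, TensorProduct.add_tmul, hy, hy']
    | tmul n z => simp

lemma tensorCoact_coassoc_left (x : M ⊗[k] H) (y : N ⊗[k] H) :
    TensorProduct.assoc k (M ⊗[A] N) H H
        ((tensorCoact M N).rTensor H (tensorMulMap M N H x y)) =
      tensorMulMap M N (H ⊗[k] H) (TensorProduct.assoc k M H H (M.coact.rTensor H x))
        (TensorProduct.assoc k N H H (N.coact.rTensor H y)) := by
  induction x with
  | zero => simp
  | add x x' hx hx' => simp only [map_add, LinearMap.add_apply, hx, hx']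
  | tmul m w =>
    induction y with
    | zero => simp
    | add y y' hy hy' => simp only [map_add, hy, hy']
    | tmul n z =>
      simp only [tensorMulMap_tmul, LinearMap.rTensor_tmul, tensorCoact_tmul, assoc_tensorMulMap]

lemma tensorCoact_coassoc_right (x : M ⊗[k] H) (y : N ⊗[k] H) :
    (Coalgebra.comul (R := k) (A := H)).lTensor (M ⊗[A] N) (tensorMulMap M N H x y) =
      tensorMulMap M N (H ⊗[k] H) ((Coalgebra.comul (R := k) (A := H)).lTensor M x)
        ((Coalgebra.comul (R := k) (A := H)).lTensor N y) := by
  induction x with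
  | zero => simp
  | add x x' hx hx' => simp only [map_add, LinearMap.add_apply, hx, hx']
  | tmul m w =>
    induction y with
    | zero => simp
    | add y y' hy hy' => simp only [map_add, hy, hy']
    | tmul n z => simp

lemma tensorCoact_counit (x : M ⊗[k] H) (y : N ⊗[k] H) :
    TensorProduct.rid k (M ⊗[A] N)
        ((Coalgebra.counit (R := k) (A := H)).lTensor (M ⊗[A] N) (tensorMulMap M N H x y)) =
      (TensorProduct.rid k M ((Coalgebra.counit (R := k) (A := H)).lTensor M x)) ⊗ₜ[A]
        (TensorProduct.rid k N ((Coalgebra.counit (R := k) (A := H)).lTensor N y)) := by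
  induction x with
  | zero => simp
  | add x x' hx hx' =>
    simp only [map_add, LinearMap.add_apply, TensorProduct.add_tmul, hx, hx']
  | tmul m w =>
    induction y with
    | zero => simp
    | add y y' hy hy' => simp only [map_add, TensorProduct.tmul_add, hy, hy']
    | tmul n z =>
      simp only [tensorMulMap_tmul, LinearMap.lTensor_tmul, TensorProduct.rid_tmul,
        Bialgebra.counit_mul]
      rw [← TensorProduct.smul_tmul', TensorProduct.tmul_smul, smul_smul]

/-- The tensor product `M ⊗_A N` of relative Hopf modules, with coaction
`m ⊗ n ↦ m₀ ⊗ n₀ ⊗ m₁ n₁`. -/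
def tensorObj : RelHopfModule k H A where
  carrier := M ⊗[A] N
  coact := tensorCoact M N
  isCoaction := by
    constructor
    · intro x
      induction x with
      | zero => simp
      | add x y hx hy => simp only [map_add, hx, hy]
      | tmul m n =>
        rw [tensorCoact_tmul, tensorCoact_coassoc_left, tensorCoact_coassoc_right,
          M.isCoaction.coassoc, N.isCoaction.coassoc]
    · intro x
      induction x with
      | zero => simp
      | add x y hx hy => simp only [map_add, hx, hy]
      | tmul m n =>
        rw [tensorCoact_tmul, tensorCoact_counit, M.isCoaction.counit, N.isCoaction.counit]
  coact_smul a x := by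
    induction x with
    | zero => simp
    | add x y hx hy => rw [smul_add, map_add, hx, hy, map_add, map_add]
    | tmul m n =>
      rw [TensorProduct.smul_tmul', tensorCoact_tmul, tensorCoact_tmul, M.coact_smul,
        tensorMulMap_smul_left]

end Tensor

end RelHopfModule

namespace RelHopf

section Twist

variable {k H : Type*} [CommRing k] [CommRing H] {M P Q : Type*} [AddCommGroup M] [Module k M]
  [AddCommGroup P] [Module k P] [AddCommGroup Q] [Module k Q]

variable (k P) in
/-- Multiplication in the last tensor factor: `(v, p ⊗ w) ↦ p ⊗ v w`. -/
def coeffMul (V : Type*) [CommRing V] [Algebra k V] : V →ₗ[k] P ⊗[k] V →ₗ[k] P ⊗[k] V :=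
  LinearMap.lTensorHom P ∘ₗ LinearMap.mul k V

section

variable {V : Type*} [CommRing V] [Algebra k V]

@[simp] lemma coeffMul_tmul (v w : V) (p : P) :
    coeffMul k P V v (p ⊗ₜ w) = p ⊗ₜ (v * w) := rfl

lemma coeffMul_mul (v w : V) (x : P ⊗[k] V) :
    coeffMul k P V (v * w) x = coeffMul k P V v (coeffMul k P V w x) := by
  induction x with
  | zero => simp
  | add x y hx hy => simp only [map_add, hx, hy]
  | tmul p z => simp [mul_assoc]

lemma coeffMul_algebraMap (c : k) (x : P ⊗[k] V) :
    coeffMul k P V (algebraMap k V c) x = c • x := by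
  induction x with
  | zero => simp
  | add x y hx hy => simp only [map_add, hx, hy, smul_add]
  | tmul p z => simp [Algebra.algebraMap_eq_smul_one]

lemma coeffMul_tensorSMul {A : Type*} [CommRing A] [Algebra k A] [Module A P]
    [IsScalarTower k A P] (v w : V) (t : A ⊗[k] V) (x : P ⊗[k] V) :
    coeffMul k P V (v * w) (tensorSMul k V A P t x) =
      tensorSMul k V A P (coeffMul k A V v t) (coeffMul k P V w x) := by
  induction t with
  | zero => simp
  | add s t hs ht => simp only [map_add, LinearMap.add_apply, hs, ht]
  | tmul a u =>
    induction x with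
    | zero => simp
    | add x y hx hy => simp only [map_add, hx, hy]
    | tmul p z => simp [mul_mul_mul_comm]

end

lemma cancel [Bialgebra k H] {ρ : M →ₗ[k] M ⊗[k] H} (hρ : IsCoaction ρ) (W : M →ₗ[k] Q)
    (β : H ⊗[k] H →ₗ[k] Q →ₗ[k] Q)
    (hβ : ∀ h q, β (Coalgebra.comul h) q = (Coalgebra.counit (R := k) h) • q) (m : M) :
    TensorProduct.lift (β.flip ∘ₗ W) (TensorProduct.assoc k M H H (ρ.rTensor H (ρ m))) = W m := by
  have h1 : ∀ x : M ⊗[k] H, TensorProduct.lift (β.flip ∘ₗ W)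
      ((Coalgebra.comul (R := k) (A := H)).lTensor M x) =
      W (TensorProduct.rid k M ((Coalgebra.counit (R := k) (A := H)).lTensor M x)) := by
    intro x
    induction x with
    | zero => simp
    | add x y hx hy => simp only [map_add, hx, hy]
    | tmul m h => simp [hβ]
  rw [hρ.coassoc, h1, hρ.counit]

variable [HopfAlgebra k H]

/-- The map `m ⊗ h ↦ S⁻¹(h) L(m)` on `M ⊗ H`, where `H` multiplies the last factor of `P ⊗ H`. -/
def twist (L : M →ₗ[k] P ⊗[k] H) : M ⊗[k] H →ₗ[k] P ⊗[k] H :=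
  TensorProduct.lift ((coeffMul k P H ∘ₗ antipodeInv k H).flip ∘ₗ L)

@[simp] lemma twist_tmul (L : M →ₗ[k] P ⊗[k] H) (m : M) (h : H) :
    twist L (m ⊗ₜ h) = coeffMul k P H (antipodeInv k H h) (L m) := rfl

variable (k H) in
/-- `g ⊗ h ↦ S⁻¹(h) g`. -/
def betaRight : H ⊗[k] H →ₗ[k] H :=
  LinearMap.mul' k H ∘ₗ (antipodeInv k H).lTensor H

variable (k H) in
/-- `g ⊗ h ↦ S⁻¹(g) h`. -/
def betaLeft : H ⊗[k] H →ₗ[k] H :=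
  LinearMap.mul' k H ∘ₗ (antipodeInv k H).rTensor H

lemma antipodeInv_eq_antipode : antipodeInv k H = HopfAlgebra.antipode k :=
  LinearMap.ext antipodeInv_eq

lemma betaRight_comul (h : H) : betaRight k H (Coalgebra.comul h) =
    algebraMap k H (Coalgebra.counit h) := by
  rw [betaRight, antipodeInv_eq_antipode, LinearMap.comp_apply,
    HopfAlgebra.mul_antipode_lTensor_comul_apply]

lemma betaLeft_comul (h : H) : betaLeft k H (Coalgebra.comul h) =
    algebraMap k H (Coalgebra.counit h) := by
  rw [betaLeft, antipodeInv_eq_antipode, LinearMap.comp_apply,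
    HopfAlgebra.mul_antipode_rTensor_comul_apply]

/-- `m₀ ⊗ S⁻¹(m₂) m₁ = m ⊗ 1`. -/
lemma twist_coact {ρ : M →ₗ[k] M ⊗[k] H} (hρ : IsCoaction ρ) (m : M) :
    twist ρ (ρ m) = m ⊗ₜ 1 := by
  have h := cancel hρ ((TensorProduct.mk k M H).flip 1) (coeffMul k M H ∘ₗ betaRight k H)
    (fun h q => by rw [LinearMap.comp_apply, betaRight_comul, coeffMul_algebraMap]) m
  rw [LinearMap.flip_apply, TensorProduct.mk_apply] at h
  rw [← h]
  generalize ρ m = x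
  induction x with
  | zero => simp
  | add x y hx hy => simp only [map_add, hx, hy]
  | tmul n h =>
    rw [twist_tmul, LinearMap.rTensor_tmul]
    generalize ρ n = y
    induction y with
    | zero => simp
    | add x y hx hy => simp only [map_add, TensorProduct.add_tmul, hx, hy]
    | tmul n g => simp [betaRight, mul_comm]

variable {V : Type*} [CommRing V] [Algebra k V]

/-- The map `m ⊗ v ↦ v φ(m)` on `M ⊗ V`, where `V` multiplies the last factor of `P ⊗ V`. -/
def mulExt (φ : M →ₗ[k] P ⊗[k] V) : M ⊗[k] V →ₗ[k] P ⊗[k] V :=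
  TensorProduct.lift ((coeffMul k P V).flip ∘ₗ φ)

@[simp] lemma mulExt_tmul (φ : M →ₗ[k] P ⊗[k] V) (m : M) (v : V) :
    mulExt φ (m ⊗ₜ v) = coeffMul k P V v (φ m) := rfl

lemma mulExt_twist {ρ : M →ₗ[k] M ⊗[k] H} (hρ : IsCoaction ρ) (L : M →ₗ[k] P ⊗[k] H) (m : M) :
    mulExt (twist L ∘ₗ ρ) (ρ m) = L m := by
  have h := cancel hρ L (coeffMul k P H ∘ₗ betaLeft k H)
    (fun h q => by rw [LinearMap.comp_apply, betaLeft_comul, coeffMul_algebraMap]) m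
  rw [← h]
  generalize ρ m = x
  induction x with
  | zero => simp
  | add x y hx hy => simp only [map_add, hx, hy]
  | tmul n h =>
    rw [mulExt_tmul, LinearMap.rTensor_tmul, LinearMap.comp_apply]
    generalize ρ n = y
    induction y with
    | zero => simp
    | add x y hx hy => simp only [map_add, TensorProduct.add_tmul, hx, hy]
    | tmul n g =>
      simp [betaLeft, ← coeffMul_mul, mul_comm]

lemma mulExt_injective {ρ : M →ₗ[k] M ⊗[k] H} (hρ : IsCoaction ρ) (α : H →ₐ[k] V)
    (φ ψ : M →ₗ[k] P ⊗[k] V)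
    (h : ∀ m, mulExt φ (α.toLinearMap.lTensor M (ρ m)) =
      mulExt ψ (α.toLinearMap.lTensor M (ρ m))) : φ = ψ := by
  have key : ∀ (χ : M →ₗ[k] P ⊗[k] V) (m : M),
      TensorProduct.lift ((coeffMul k P V ∘ₗ (α.toLinearMap ∘ₗ antipodeInv k H)).flip ∘ₗ
        (mulExt χ ∘ₗ α.toLinearMap.lTensor M ∘ₗ ρ)) (ρ m) = χ m := by
    intro χ m
    have h := cancel hρ χ (coeffMul k P V ∘ₗ α.toLinearMap ∘ₗ betaRight k H)
      (fun h q => by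
        rw [LinearMap.comp_apply, LinearMap.comp_apply, betaRight_comul]
        simp [coeffMul_algebraMap]) m
    refine Eq.trans ?_ h
    generalize ρ m = x
    induction x with
    | zero => simp
    | add x y hx hy => simp only [map_add, hx, hy]
    | tmul n h =>
      rw [LinearMap.rTensor_tmul, TensorProduct.lift.tmul, LinearMap.comp_apply,
        LinearMap.comp_apply, LinearMap.comp_apply]
      generalize ρ n = y
      induction y with
      | zero => simp
      | add x y hx hy => simp only [map_add, LinearMap.add_apply, TensorProduct.add_tmul, hx, hy]
      | tmul n g =>
        simp [betaRight, ← coeffMul_mul, mul_comm]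
  have e : mulExt φ ∘ₗ α.toLinearMap.lTensor M ∘ₗ ρ =
      mulExt ψ ∘ₗ α.toLinearMap.lTensor M ∘ₗ ρ := LinearMap.ext h
  ext m
  rw [← key φ m, ← key ψ m, e]

end Twist

end RelHopf

namespace RelHopfModule

/-! ### The Hom object -/

section HomObj

open RelHopf

variable {k H A : Type u} [CommRing k] [CommRing H] [HopfAlgebra k H]
    [CommRing A] [Algebra k A] [ComoduleAlgebra k H A] (N P : RelHopfModule k H A)

lemma twist_tensorSMul (f : N →ₗ[A] P) (t : A ⊗[k] H) (x : N ⊗[k] H) :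
    twist (P.coact ∘ₗ f.restrictScalars k) (tensorSMul k H A N t x) =
      tensorSMul k H A P
        (twist (ComoduleAlgebra.coact (k := k) (H := H) (A := A)).toLinearMap t)
        (twist (P.coact ∘ₗ f.restrictScalars k) x) := by
  induction t with
  | zero => simp
  | add s t hs ht => simp only [map_add, LinearMap.add_apply, hs, ht]
  | tmul a h =>
    induction x with
    | zero => simp
    | add x y hx hy => simp only [map_add, hx, hy]
    | tmul n g =>
      simp only [tensorSMul_tmul, twist_tmul, LinearMap.comp_apply, LinearMap.restrictScalars_apply,
        map_smul, P.coact_smul, antipodeInv_eq, HopfAlgebra.antipode_mul_distrib,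
        coeffMul_tensorSMul, AlgHom.toLinearMap_apply]

lemma tensorSMul_one (a : A) (x : P ⊗[k] H) : tensorSMul k H A P (a ⊗ₜ 1) x = a • x := by
  induction x with
  | zero => simp
  | add x y hx hy => simp only [map_add, hx, hy, smul_add]
  | tmul p h => simp [TensorProduct.smul_tmul']

/-- For an `A`-linear map `f`, the `A`-linear map `n ↦ f(n₀)₀ ⊗ S⁻¹(n₁) f(n₀)₁`. -/
def homTwist (f : N →ₗ[A] P) : N →ₗ[A] P ⊗[k] H where
  toFun n := twist (P.coact ∘ₗ f.restrictScalars k) (N.coact n)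
  map_add' m n := by rw [map_add, map_add]
  map_smul' a n := by
    have h : twist (ComoduleAlgebra.coact (k := k) (H := H) (A := A)).toLinearMap
        (ComoduleAlgebra.coact (k := k) (H := H) a) = a ⊗ₜ 1 :=
      twist_coact ComoduleAlgebra.isCoaction a
    rw [N.coact_smul, twist_tensorSMul, h, tensorSMul_one, RingHom.id_apply]

lemma homTwist_restrictScalars (f : N →ₗ[A] P) : (homTwist N P f).restrictScalars k =
    twist (P.coact ∘ₗ f.restrictScalars k) ∘ₗ N.coact := rfl

/-- `homTwist` as a `k`-linear map. -/
def homTwistLin : (N →ₗ[A] P) →ₗ[k] (N →ₗ[A] P ⊗[k] H) where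
  toFun := homTwist N P
  map_add' f g := by
    ext n
    change twist _ (N.coact n) = twist _ (N.coact n) + twist _ (N.coact n)
    generalize N.coact n = x
    induction x with
    | zero => simp
    | add x y hx hy => simp only [map_add, hx, hy]; abel
    | tmul n h => simp
  map_smul' c f := by
    ext n
    change twist _ (N.coact n) = c • twist _ (N.coact n)
    generalize N.coact n = x
    induction x with
    | zero => simp
    | add x y hx hy => simp only [map_add, hx, hy, smul_add]
    | tmul n h => simp

variable {V : Type*} [CommRing V] [Algebra k V]

/-- `(f ⊗ v, n) ↦ f(n₀) ⊗ α(n₁) v`. -/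
def ev (α : H →ₐ[k] V) (x : (N →ₗ[A] P) ⊗[k] V) (n : N) : P ⊗[k] V :=
  mulExt ((homTensorMap k A N P V x).restrictScalars k) (α.toLinearMap.lTensor N (N.coact n))

lemma ev_add (α : H →ₐ[k] V) (x y : (N →ₗ[A] P) ⊗[k] V) (n : N) :
    ev N P α (x + y) n = ev N P α x n + ev N P α y n := by
  unfold ev
  generalize α.toLinearMap.lTensor N (N.coact n) = z
  induction z with
  | zero => simp
  | add z z' hx hy => simp only [map_add] at hx hy ⊢; rw [hx, hy]; abel
  | tmul n h => simp

lemma ev_zero (α : H →ₐ[k] V) (n : N) : ev N P α 0 n = 0 := by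
  have := ev_add N P α 0 0 n
  simpa using this

lemma ev_tensorSMul (t : A ⊗[k] H) (x : (N →ₗ[A] P) ⊗[k] H) (n : N) :
    ev N P (AlgHom.id k H) (tensorSMul k H A (N →ₗ[A] P) t x) n =
      tensorSMul k H A P t (ev N P (AlgHom.id k H) x n) := by
  induction t with
  | zero => simp [ev_zero]
  | add s t hs ht => simp only [map_add, LinearMap.add_apply, hs, ht, ev_add]
  | tmul a h =>
    induction x with
    | zero => simp [ev_zero]
    | add x y hx hy => simp only [map_add, hx, hy, ev_add]
    | tmul f g =>
      rw [tensorSMul_tmul]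
      unfold ev
      generalize (AlgHom.id k H).toLinearMap.lTensor N (N.coact n) = z
      induction z with
      | zero => simp
      | add z z' hx hy => simp only [map_add, hx, hy]
      | tmul n u => simp [mul_left_comm]

lemma ev_comul (x : (N →ₗ[A] P) ⊗[k] H) (n : N) :
    ev N P (Bialgebra.comulAlgHom k H)
        ((Coalgebra.comul (R := k) (A := H)).lTensor (N →ₗ[A] P) x) n =
      (Coalgebra.comul (R := k) (A := H)).lTensor P (ev N P (AlgHom.id k H) x n) := by
  induction x with
  | zero => simp [ev_zero]
  | add x y hx hy => simp only [map_add, hx, hy, ev_add]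
  | tmul f g =>
    unfold ev
    generalize N.coact n = z
    induction z with
    | zero => simp
    | add z z' hx hy => simp only [map_add, hx, hy]
    | tmul n u => simp

/-- `ev` as a linear map in the second variable. -/
def evLin (x : (N →ₗ[A] P) ⊗[k] H) : N →ₗ[k] P ⊗[k] H :=
  mulExt ((homTensorMap k A N P H x).restrictScalars k) ∘ₗ
    (AlgHom.id k H).toLinearMap.lTensor N ∘ₗ N.coact

lemma evLin_apply (x : (N →ₗ[A] P) ⊗[k] H) (n : N) :
    evLin N P x n = ev N P (AlgHom.id k H) x n := rfl

lemma ev_assoc (y : (N →ₗ[A] P) ⊗[k] H) (h : H) (n : N) :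
    ev N P (Bialgebra.comulAlgHom k H)
        (TensorProduct.assoc k (N →ₗ[A] P) H H (y ⊗ₜ h)) n =
      TensorProduct.assoc k P H H
        (TensorProduct.map (evLin N P y) (LinearMap.mul k H h) (N.coact n)) := by
  have hN : (Bialgebra.comulAlgHom k H).toLinearMap.lTensor N (N.coact n) =
      TensorProduct.assoc k N H H (N.coact.rTensor H (N.coact n)) :=
    (N.isCoaction.coassoc n).symm
  unfold ev
  rw [hN]
  generalize N.coact n = x
  induction x with
  | zero => simp
  | add x x' hx hx' => simp only [map_add, hx, hx']
  | tmul m u =>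
    rw [LinearMap.rTensor_tmul, TensorProduct.map_tmul, evLin, LinearMap.comp_apply,
      LinearMap.comp_apply]
    generalize N.coact m = z
    induction z with
    | zero => simp
    | add z z' hz hz' => simp only [map_add, TensorProduct.add_tmul, hz, hz']
    | tmul m w =>
      induction y with
      | zero => simp
      | add y y' hy hy' =>
        simp only [TensorProduct.assoc_tmul, LinearMap.lTensor_tmul, mulExt_tmul,
          LinearMap.restrictScalars_apply, map_add, LinearMap.add_apply,
          TensorProduct.add_tmul] at hy hy' ⊢
        rw [hy, hy']
      | tmul f v => simp [mul_comm]

lemma rid_counit_coeffMul {X : Type*} [AddCommGroup X] [Module k X] (h : H) (x : X ⊗[k] H) :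
    TensorProduct.rid k X
        ((Coalgebra.counit (R := k) (A := H)).lTensor X (coeffMul k X H h x)) =
      (Coalgebra.counit (R := k) h) •
        TensorProduct.rid k X ((Coalgebra.counit (R := k) (A := H)).lTensor X x) := by
  induction x with
  | zero => simp
  | add x y hx hy => simp only [map_add, hx, hy, smul_add]
  | tmul p g => simp [mul_smul]

lemma rid_counit_homTensorMap (x : (N →ₗ[A] P) ⊗[k] H) (n : N) :
    TensorProduct.rid k (N →ₗ[A] P)
        ((Coalgebra.counit (R := k) (A := H)).lTensor (N →ₗ[A] P) x) n =
      TensorProduct.rid k P ((Coalgebra.counit (R := k) (A := H)).lTensor P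
        (homTensorMap k A N P H x n)) := by
  induction x with
  | zero => simp
  | add x y hx hy => simp only [map_add, LinearMap.add_apply, hx, hy]
  | tmul f h => simp

lemma rid_counit_homTwist (f : N →ₗ[A] P) (n : N) :
    TensorProduct.rid k P ((Coalgebra.counit (R := k) (A := H)).lTensor P (homTwist N P f n)) =
      f n := by
  change TensorProduct.rid k P ((Coalgebra.counit (R := k) (A := H)).lTensor P
    (twist (P.coact ∘ₗ f.restrictScalars k) (N.coact n))) = f n
  conv_rhs => rw [← N.isCoaction.counit n]
  generalize N.coact n = x
  induction x with
  | zero => simp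
  | add x y hx hy => simp only [map_add, hx, hy]
  | tmul m h =>
    rw [twist_tmul, rid_counit_coeffMul, LinearMap.comp_apply, P.isCoaction.counit,
      antipodeInv_eq, HopfAlgebra.counit_antipode]
    simp

variable [Module.Finite A N] [Module.Projective A N]

/-- The isomorphism `Hom_A(N, P) ⊗ V ≅ Hom_A(N, P ⊗ V)`, for `N` finitely generated projective. -/
def homTensorEquiv (V : Type*) [AddCommGroup V] [Module k V] :
    (N →ₗ[A] P) ⊗[k] V ≃ₗ[k] (N →ₗ[A] P ⊗[k] V) :=
  LinearEquiv.ofBijective (homTensorMap k A N P V) (homTensorMap_bijective V)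

/-- The coaction `f ↦ f₀ ⊗ f₁` on `Hom_A(N, P)`, determined by
`f₀(n) ⊗ f₁ = f(n₀)₀ ⊗ S⁻¹(n₁) f(n₀)₁`. -/
def homCoact : (N →ₗ[A] P) →ₗ[k] (N →ₗ[A] P) ⊗[k] H :=
  (homTensorEquiv N P H).symm.toLinearMap ∘ₗ homTwistLin N P

lemma homTensorMap_homCoact (f : N →ₗ[A] P) :
    homTensorMap k A N P H (homCoact N P f) = homTwist N P f :=
  (homTensorEquiv N P H).apply_symm_apply (homTwist N P f)

lemma ev_ext (α : H →ₐ[k] V) {x y : (N →ₗ[A] P) ⊗[k] V} (h : ∀ n, ev N P α x n = ev N P α y n) :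
    x = y := by
  have := mulExt_injective N.isCoaction α _ _ h
  exact (homTensorMap_bijective V).1 (LinearMap.ext fun n => LinearMap.congr_fun this n)

lemma ev_homCoact (f : N →ₗ[A] P) (n : N) :
    ev N P (AlgHom.id k H) (homCoact N P f) n = P.coact (f n) := by
  have h : (AlgHom.id k H).toLinearMap = LinearMap.id := rfl
  rw [ev, homTensorMap_homCoact, homTwist_restrictScalars, h, LinearMap.lTensor_id,
    LinearMap.id_apply, mulExt_twist N.isCoaction]
  rfl

lemma evLin_homCoact (f : N →ₗ[A] P) :
    evLin N P (homCoact N P f) = P.coact ∘ₗ f.restrictScalars k :=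
  LinearMap.ext fun n => ev_homCoact N P f n

lemma ev_coact_rTensor (x : (N →ₗ[A] P) ⊗[k] H) (n : N) :
    ev N P (Bialgebra.comulAlgHom k H)
        (TensorProduct.assoc k (N →ₗ[A] P) H H ((homCoact N P).rTensor H x)) n =
      TensorProduct.assoc k P H H (P.coact.rTensor H (ev N P (AlgHom.id k H) x n)) := by
  induction x with
  | zero => simp [ev_zero]
  | add x y hx hy => simp only [map_add, hx, hy, ev_add]
  | tmul f h =>
    rw [LinearMap.rTensor_tmul, ev_assoc, evLin_homCoact]
    unfold ev
    generalize N.coact n = z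
    induction z with
    | zero => simp
    | add z z' hx hy => simp only [map_add, hx, hy]
    | tmul n u => simp [mul_comm]

lemma homCoact_isCoaction : IsCoaction (homCoact N P) where
  coassoc f := by
    apply ev_ext N P (Bialgebra.comulAlgHom k H)
    intro n
    rw [ev_coact_rTensor, ev_comul, ev_homCoact, P.isCoaction.coassoc]
  counit f := by
    ext n
    rw [rid_counit_homTensorMap, homTensorMap_homCoact, rid_counit_homTwist]

lemma homCoact_smul (a : A) (f : N →ₗ[A] P) :
    homCoact N P (a • f) =
      tensorSMul k H A (N →ₗ[A] P) (ComoduleAlgebra.coact a) (homCoact N P f) := by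
  apply ev_ext N P (AlgHom.id k H)
  intro n
  rw [ev_tensorSMul, ev_homCoact, ev_homCoact, LinearMap.smul_apply, P.coact_smul]

/-- The relative Hopf module `Hom_A(N, P)`, for `N` finitely generated projective over `A`,
with action `(a f)(n) = a f(n)` and coaction
`f₀(n) ⊗ f₁ = f(n₀)₀ ⊗ S⁻¹(n₁) f(n₀)₁`. -/
def homObj : RelHopfModule k H A where
  carrier := N →ₗ[A] P
  coact := homCoact N P
  isCoaction := homCoact_isCoaction N P
  coact_smul := homCoact_smul N P

end HomObj

end RelHopfModule

end

/-! Both inequalities come from one adjunction of exact functors, `- ⊗_A N ⊣ Hom_A(N, -)`, on the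
abelian category of relative Hopf modules.

If `F ⊣ G` and both functors are exact, they pass to derived categories without being derived, and
the adjunction passes along with them. Since `Ext^n(X, Y)` is the set of morphisms from `X` to
`Y[n]` in the derived category, this gives `Ext^n(F X, Y) ≃ Ext^n(X, G Y)` (`extEquiv`), with no
resolutions and so no need for enough projectives or injectives. If `Ext^n(X, -)` vanishes then so
does `Ext^n(F X, -)`; if `Ext^n(-, Y)` vanishes then so does `Ext^n(-, G Y)`. Hence `F` does not
raise projective dimension and `G` does not raise injective dimension.

The adjunction is the usual currying of `A`-linear maps, and the point to check is that currying
respects colinearity (`colinear_iff_curry`). The coaction on `Hom_A(N, P)` is characterised without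
the antipode by `f₀(n₀) ⊗ n₁ f₁ = ρ(f(n))`, which is `ev_homCoact`, and `ev_ext` says that such
identities determine elements of `Hom_A(N, P) ⊗ H`. Under this test, colinearity of a map and of its
curried form become the same equation on pure tensors.

For exactness, a left adjoint is right exact and a right adjoint is left exact. The missing halves
hold because `N` is flat over `A` (tensoring keeps injections) and projective over `A` (maps from
`N` lift along surjections). -/

noncomputable section

/-! ### Adjunctions of exact functors, Ext groups and homological dimensions -/

namespace CategoryTheory.Adjunction

open Abelian

universe v₁ v₂ u₁ u₂ w₁ w₂

variable {C : Type u₁} [Category.{v₁} C] {D : Type u₂} [Category.{v₂} D]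
  {F : C ⥤ D} {G : D ⥤ C}

/-- An adjunction between additive functors induces an adjunction between the functors on
categories of complexes. -/
def mapHomologicalComplex [Preadditive C] [Preadditive D] (adj : F ⊣ G) [F.Additive] [G.Additive]
    {ι : Type*} (c : ComplexShape ι) :
    F.mapHomologicalComplex c ⊣ G.mapHomologicalComplex c where
  unit :=
    { app K :=
        { f i := adj.unit.app (K.X i)
          comm' _ _ _ := (adj.unit.naturality _).symm }
      naturality _ _ _ := by
        ext i
        exact adj.unit.naturality _ }
  counit :=
    { app K :=
        { f i := adj.counit.app (K.X i)
          comm' _ _ _ := (adj.counit.naturality _).symm }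
      naturality _ _ _ := by
        ext i
        exact adj.counit.naturality _ }
  left_triangle_components K := by
    ext i
    exact adj.left_triangle_components (K.X i)
  right_triangle_components K := by
    ext i
    exact adj.right_triangle_components (K.X i)

variable [Abelian C] [Abelian D] (adj : F ⊣ G)

section

variable [F.Additive] [G.Additive] [PreservesFiniteLimits F] [PreservesFiniteColimits F]
  [PreservesFiniteLimits G] [PreservesFiniteColimits G]

/-- An adjunction between exact functors induces an adjunction between derived categories. -/
def mapDerivedCategory [HasDerivedCategory.{w₁} C] [HasDerivedCategory.{w₂} D] :
    F.mapDerivedCategory ⊣ G.mapDerivedCategory :=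
  -- An adjunction descends to localizations once both functors do. These squares record the
  -- descent, which exists because exact functors preserve quasi-isomorphisms.
  letI : CatCommSq (F.mapHomologicalComplex (ComplexShape.up ℤ)) DerivedCategory.Q
    DerivedCategory.Q F.mapDerivedCategory := ⟨F.mapDerivedCategoryFactors.symm⟩
  letI : CatCommSq (G.mapHomologicalComplex (ComplexShape.up ℤ)) DerivedCategory.Q
    DerivedCategory.Q G.mapDerivedCategory := ⟨G.mapDerivedCategoryFactors.symm⟩
  (adj.mapHomologicalComplex (ComplexShape.up ℤ)).localization
    DerivedCategory.Q (HomologicalComplex.quasiIso C (ComplexShape.up ℤ))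
    DerivedCategory.Q (HomologicalComplex.quasiIso D (ComplexShape.up ℤ)) _ _

/-- For an adjunction `F ⊣ G` between exact functors, `Ext^n(F X, Y) ≃ Ext^n(X, G Y)`. -/
def extEquiv [HasExt.{w₁} C] [HasExt.{w₂} D] (X : C) (Y : D) (n : ℕ) :
    Ext.{w₂} (F.obj X) Y n ≃ Ext.{w₁} X (G.obj Y) n :=
  letI := HasDerivedCategory.standard C
  letI := HasDerivedCategory.standard D
  -- With `X`, `Y` seen as complexes in degree `0`, the chain reads `Hom(F X, Y[n]) ≃ Hom(X, G
  -- (Y[n])) ≃ Hom(X, (G Y)[n])`. The other links identify `F` and `G` of a one-term complex with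
  -- the one-term complex on the image.
  Ext.homEquiv.trans <|
    ((F.mapDerivedCategorySingleFunctor 0).symm.app X).homFromEquiv.trans <|
    (adj.mapDerivedCategory.homEquiv _ _).trans <|
    ((G.mapDerivedCategory.commShiftIso (n : ℤ)).app _).homToEquiv.trans <|
    ((shiftFunctor _ (n : ℤ)).mapIso
      ((G.mapDerivedCategorySingleFunctor 0).app Y)).homToEquiv.trans Ext.homEquiv.symm

-- A bare bijection of Ext sets suffices: a set in bijection with a one-element set has one element,
-- so additivity of `extEquiv` is never needed. The test object `Y` is moved to `G.obj Y`.
include adj in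
lemma hasProjectiveDimensionLT_obj (X : C) (n : ℕ) [HasProjectiveDimensionLT X n] :
    HasProjectiveDimensionLT (F.obj X) n := by
  let := HasExt.standard C
  let := HasExt.standard D
  rw [hasProjectiveDimensionLT_iff]
  intro i hi Y e
  exact (adj.extEquiv X Y i).injective
    ((HasProjectiveDimensionLT.subsingleton X n i hi (G.obj Y)).elim _ _)

-- Dual to the projective case: the test object `X` is moved to `F.obj X`.
include adj in
lemma hasInjectiveDimensionLT_obj (Y : D) (n : ℕ) [HasInjectiveDimensionLT Y n] :
    HasInjectiveDimensionLT (G.obj Y) n := by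
  let := HasExt.standard C
  let := HasExt.standard D
  rw [hasInjectiveDimensionLT_iff]
  intro i hi X e
  exact (adj.extEquiv X Y i).symm.injective
    ((HasInjectiveDimensionLT.subsingleton Y n i hi (F.obj X)).elim _ _)

include adj in
/-- A left adjoint, exact with exact right adjoint, does not raise the projective dimension. -/
lemma projectiveDimension_obj_le (X : C) :
    projectiveDimension (F.obj X) ≤ projectiveDimension X := by
  -- The dimension is the infimum of those `n` in `WithBot ℕ∞` such that `HasProjectiveDimensionLT`
  -- holds for every natural `i > n`; each bound for `X` is one for `F.obj X`. Taking `n = ⊥` allows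
  -- `i = 0`, which covers zero objects.
  refine sInf_le_sInf fun n hn i hi => ?_
  have := hn i hi
  exact adj.hasProjectiveDimensionLT_obj X i

include adj in
/-- A right adjoint, exact with exact left adjoint, does not raise the injective dimension. -/
lemma injectiveDimension_obj_le (Y : D) :
    injectiveDimension (G.obj Y) ≤ injectiveDimension Y := by
  refine sInf_le_sInf fun n hn i hi => ?_
  have := hn i hi
  exact adj.hasInjectiveDimensionLT_obj Y i

end

-- A left adjoint is right exact, so the image of a short exact sequence is already exact in the
-- middle; left exactness then only asks that the first map stay a monomorphism.
include adj in
lemma preservesFiniteLimits_left_of_preservesMonomorphisms [F.Additive] [F.PreservesMonomorphisms] :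
    PreservesFiniteLimits F := by
  have := adj.leftAdjoint_preservesColimits
  rw [Functor.preservesFiniteLimits_iff_forall_exact_map_and_mono]
  intro S hS
  have := hS.mono_f
  exact ⟨((Functor.preservesFiniteColimits_iff_forall_exact_map_and_epi F).1
    inferInstance S hS).1, inferInstance⟩

-- A right adjoint is left exact, so only the surjective end of a short exact sequence can fail, and
-- preservation of epimorphisms repairs it.
include adj in
lemma preservesFiniteColimits_right_of_preservesEpimorphisms [G.Additive] [G.PreservesEpimorphisms] :
    PreservesFiniteColimits G := by
  have := adj.rightAdjoint_preservesLimits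
  rw [Functor.preservesFiniteColimits_iff_forall_exact_map_and_epi]
  intro S hS
  have := hS.epi_g
  exact ⟨((Functor.preservesFiniteLimits_iff_forall_exact_map_and_mono G).1
    inferInstance S hS).1, inferInstance⟩

end CategoryTheory.Adjunction

namespace RelHopfModule

variable {k H A : Type u} [CommRing k] [CommRing H] [CommRing A] [Algebra k A]

/-! ### The functor `- ⊗_A N` -/

section Tensor

variable [Bialgebra k H] [ComoduleAlgebra k H A]

lemma rTensor_tensorMulMap {M M' : RelHopfModule k H A} (N : RelHopfModule k H A) (f : M →ₗ[A] M')
    (x : M ⊗[k] H) (y : N ⊗[k] H) :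
    ((f.rTensor N).restrictScalars k).rTensor H (tensorMulMap M N H x y) =
      tensorMulMap M' N H ((f.restrictScalars k).rTensor H x) y := by
  induction x with
  | zero => simp
  | add x x' hx hx' => simp only [map_add, LinearMap.add_apply, hx, hx']
  | tmul m h =>
    induction y with
    | zero => simp
    | add y y' hy hy' => simp only [map_add, hy, hy']
    | tmul n g => simp

lemma rTensor_tensorCoact {M M' : RelHopfModule k H A} (N : RelHopfModule k H A) (f : M ⟶ M')
    (x : M ⊗[A] N) :
    ((f.toLin.rTensor N).restrictScalars k).rTensor H (tensorCoact M N x) =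
      tensorCoact M' N (f.toLin.rTensor N x) := by
  induction x with
  | zero => simp
  | add x y hx hy => simp only [map_add, hx, hy]
  | tmul m n =>
    rw [tensorCoact_tmul, rTensor_tensorMulMap, f.colinear, LinearMap.rTensor_tmul,
      tensorCoact_tmul]

/-- The functor `M ↦ M ⊗_A N`. -/
def tensorRightFunctor (N : RelHopfModule k H A) : RelHopfModule k H A ⥤ RelHopfModule k H A where
  obj M := tensorObj M N
  map f := ⟨f.toLin.rTensor N, rTensor_tensorCoact N f⟩
  map_id M := by
    apply Hom.ext
    exact LinearMap.rTensor_id N M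
  map_comp f g := by
    apply Hom.ext
    exact LinearMap.rTensor_comp N g.toLin f.toLin

instance (N : RelHopfModule k H A) : (tensorRightFunctor N).Additive where
  map_add {_ _ f g} := by
    apply Hom.ext
    exact LinearMap.rTensor_add N f.toLin g.toLin

/-- Two flatness conditions play different roles: `H` flat over `k` makes kernels those of the
underlying modules, so that monomorphisms are injective, and `N` flat over `A` keeps them injective
after tensoring. -/
instance (N : RelHopfModule k H A) [Module.Flat k H] [Module.Flat A N] :
    (tensorRightFunctor N).PreservesMonomorphisms where
  preserves f _ := mono_of_injective _
    (Module.Flat.rTensor_preserves_injective_linearMap f.toLin (injective_of_mono f))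

end Tensor

/-! ### The functor `Hom_A(N, -)` and the adjunction -/

section HomObj

variable [HopfAlgebra k H] [ComoduleAlgebra k H A]

lemma ev_rTensor_comp (N : RelHopfModule k H A) {P Q : RelHopfModule k H A} (g : P →ₗ[A] Q)
    (x : (N →ₗ[A] P) ⊗[k] H) (n : N) :
    ev N Q (AlgHom.id k H) (((LinearMap.compRight A g : (N →ₗ[A] P) →ₗ[A] (N →ₗ[A] Q)).restrictScalars k).rTensor H x)
          n =
      (g.restrictScalars k).rTensor H (ev N P (AlgHom.id k H) x n) := by
  induction x with
  | zero => simp [ev_zero]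
  | add x y hx hy => simp only [map_add, hx, hy, ev_add]
  | tmul f h =>
    unfold ev
    generalize (AlgHom.id k H).toLinearMap.lTensor N (N.coact n) = z
    induction z with
    | zero => simp
    | add z z' hx hy => simp only [map_add, hx, hy]
    | tmul m u => simp

/-- The bridge between the two coactions: for `x = m₀ ⊗ m₁`, testing the curried map by `ev` gives
`f(m₀ ⊗ n₀) ⊗ m₁ n₁`, the image under `f` of the coaction on `M ⊗_A N`. -/
lemma ev_rTensor_curry {M N P : RelHopfModule k H A} (f : M ⊗[A] N →ₗ[A] P)
    (x : M ⊗[k] H) (n : N) :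
    ev N P (AlgHom.id k H)
        (((TensorProduct.curry f : M →ₗ[A] N →ₗ[A] P).restrictScalars k).rTensor H x) n =
      (f.restrictScalars k).rTensor H (tensorMulMap M N H x (N.coact n)) := by
  have hid : (AlgHom.id k H).toLinearMap = LinearMap.id := rfl
  induction x with
  | zero => simp [ev_zero]
  | add x y hx hy => simp only [map_add, LinearMap.add_apply, hx, hy, ev_add]
  | tmul m h =>
    unfold ev
    rw [hid, LinearMap.lTensor_id, LinearMap.id_apply]
    generalize N.coact n = z
    induction z with
    | zero => simp
    | add z z' hx hy => simp only [map_add, hx, hy]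
    -- `ev` puts the coefficient from `N` on the left and `tensorMulMap` puts it on the right;
    -- commutativity of `H` reconciles them.
    | tmul m u => simp [mul_comm]

variable (N : RelHopfModule k H A) [Module.Finite A N] [Module.Projective A N]

/-- Tested by `ev` at `n`, both sides become the coaction of `Q` on `g(f(n))`, so the antipode never
has to be handled. -/
lemma rTensor_homCoact {P Q : RelHopfModule k H A} (g : P ⟶ Q) (f : N →ₗ[A] P) :
    ((LinearMap.compRight A g.toLin : (N →ₗ[A] P) →ₗ[A] (N →ₗ[A] Q)).restrictScalars k).rTensor H
      (homCoact N P f) = homCoact N Q (g.toLin ∘ₗ f) :=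
  ev_ext N Q (AlgHom.id k H) fun n => by
    rw [ev_rTensor_comp, ev_homCoact, ev_homCoact, g.colinear, LinearMap.comp_apply]

/-- The functor `P ↦ Hom_A(N, P)`. -/
def homFunctor : RelHopfModule k H A ⥤ RelHopfModule k H A where
  obj P := homObj N P
  map g := ⟨LinearMap.compRight A g.toLin, rTensor_homCoact N g⟩
  map_id _ := rfl
  map_comp _ _ := rfl

instance : (homFunctor N).Additive where
  map_add {_ _ f g} := by
    apply Hom.ext
    exact LinearMap.ext fun h => LinearMap.add_comp h g.toLin f.toLin

/-- Elements of the Hom object are arbitrary `A`-linear maps, so an `A`-linear lift, not necessarily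
colinear, is enough; projectivity of `N` over `A` provides it. -/
instance : (homFunctor N).PreservesEpimorphisms where
  preserves g _ := epi_of_surjective _ fun f =>
    Module.projective_lifting_property g.toLin f (surjective_of_epi g)

/-- An `A`-linear map `M ⊗_A N → P` is colinear iff its curried form `M → Hom_A(N, P)` is. -/
lemma colinear_iff_curry {M P : RelHopfModule k H A}
    (f : M ⊗[A] N →ₗ[A] P) :
    (∀ x, (f.restrictScalars k).rTensor H (tensorCoact M N x) = P.coact (f x)) ↔
      ∀ m, ((TensorProduct.curry f : M →ₗ[A] N →ₗ[A] P).restrictScalars k).rTensor H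
        (M.coact m) = homCoact N P (TensorProduct.curry f m) := by
  refine ⟨fun h m => ev_ext N P (AlgHom.id k H) fun n => ?_, fun h x => ?_⟩
  -- After `ev`, the required equality at `n` is the colinearity of `f` at `m ⊗ n`. The converse
  -- reads the same equation backwards, pure tensors being enough by additivity.
  · rw [ev_rTensor_curry, ev_homCoact, TensorProduct.curry_apply, ← h, tensorCoact_tmul]
  · induction x with
    | zero => simp
    | add x y hx hy => simp only [map_add, hx, hy]
    | tmul m n =>
      rw [tensorCoact_tmul, ← ev_rTensor_curry, h, ev_homCoact, TensorProduct.curry_apply]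

/-- The functor `- ⊗_A N` is left adjoint to `Hom_A(N, -)`. -/
def tensorHomAdjunction : tensorRightFunctor N ⊣ homFunctor N :=
  Adjunction.mkOfHomEquiv
    { homEquiv M P :=
        { toFun f := ⟨TensorProduct.curry f.toLin, (colinear_iff_curry N f.toLin).1 f.colinear⟩
          invFun g := ⟨TensorProduct.lift g.toLin, (colinear_iff_curry N _).2 g.colinear⟩
          left_inv f := by
            apply Hom.ext
            exact TensorProduct.ext' fun _ _ => rfl
          right_inv g := rfl }
      homEquiv_naturality_left_symm f g := by
        apply Hom.ext
        exact TensorProduct.ext' fun _ _ => rfl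
      homEquiv_naturality_right f g := rfl }

end HomObj

end RelHopfModule

end

theorem corollary3p3 {k H A : Type u} [Field k] [CommRing H] [HopfAlgebra k H]
    [CommRing A] [Algebra k A] [ComoduleAlgebra k H A]
    (M N P : RelHopfModule k H A) [Module.Finite A N] [Module.Projective A N] :
    projectiveDimension (RelHopfModule.tensorObj M N) ≤ projectiveDimension M ∧
      injectiveDimension (RelHopfModule.homObj N P) ≤ injectiveDimension P := by
  have adj := RelHopfModule.tensorHomAdjunction N
  -- The four exactness properties: two are formal from the adjunction, the other two use that `N`
  -- is flat, being projective, and that `H` is flat over the field `k`.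
  have := adj.leftAdjoint_preservesColimits
  have := adj.rightAdjoint_preservesLimits
  have := adj.preservesFiniteLimits_left_of_preservesMonomorphisms
  have := adj.preservesFiniteColimits_right_of_preservesEpimorphisms
  -- The values of the two functors on objects are `tensorObj M N` and `homObj N P` by definition.
  exact ⟨adj.projectiveDimension_obj_le M, adj.injectiveDimension_obj_le P⟩
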